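/- **Conventions.** All spaces are Hausdorff. For a locally compact space $X$ let $\mathscr O(X),\mathscr C(X),\mathscr K(X)$ be the families of open, closed and compact subsets. A *topological measure* on $X$ is a set function $\mu:\mathscr O(X)\cup\mathscr C(X)\to[0,\infty]$, not identically $\infty$, such that (a) $\mu(A\sqcup B)=\mu(A)+\mu(B)$ whenever $A,B,A\sqcup B\in\mathscr O(X)\cup\mathscr K(X)$; (b) $\mu(U)=\sup\{\mu(K):K\subseteq U,\ K\in\mathscr K(X)\}$ for $U\in\mathscr O(X)$; (c) $\mu(F)=\inf\{\mu(U):F\subseteq U,\ U\in\mathscr O(X)\}$ for $F\in\mathscr C(X)$. It is a *deficient topological measure* if (a) is required only for $A,B\in\mathscr K(X)$. It is *simple* if it assumes no values other than $0$ and $1$ (so the zero set function is simple). $X^\flat$ (resp. $X^\sharp$) is the set of simple deficient topological measures (resp. simple topological measures) on $X$, with the weak topology, the coarsest topology making $\mu\mapsto\int_X f\,d\mu$ continuous for every nonnegative $f\in C_0(X)$, where $\int_X f\,d\mu=\int_0^{\|f\|}\mu(\{x:f(x)>t\})\,dt$. For $A\in\mathscr O(X)\cup\mathscr K(X)$ put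 $A^\flat=\{\mu\in X^\flat:\mu(A)=1\}$ and $A^\sharp=\{\mu\in X^\sharp:\mu(A)=1\}$, and let $\Lambda(A)=A^\flat$ (resp. $\Lambda(A)=A^\sharp$). A map $q:\mathscr O(X)\cup\mathscr K(X)\to\mathscr O(Y)\cup\mathscr K(Y)$ is an *image transformation* from $X$ to $Y$ if (1) $q(U)\in\mathscr O(Y)$ for $U\in\mathscr O(X)$ and $q(K)\in\mathscr K(Y)$ for $K\in\mathscr K(X)$; (2) $q(U)=\bigcup\{q(K):K\subseteq U,\ K\in\mathscr K(X)\}$ for $U\in\mathscr O(X)$; (3) $q(K)=\bigcap\{q(U):K\subseteq U,\ U\in\mathscr O(X)\}$ for $K\in\mathscr K(X)$; (4) $q(A\sqcup B)=q(A)\sqcup q(B)$ whenever $A,B,A\sqcup B\in\mathscr O(X)\cup\mathscr K(X)$. It is a *d-image transformation* if (4) is required only for $A,B\in\mathscr K(X)$. The adjoint $q^*$ sends a set function $\nu$ on $\mathscr O(Y)\cup\mathscr C(Y)$ to the set function on $\mathscr O(X)\cup\mathscr C(X)$ given by $(q^*\nu)(A)=\nu(q(A))$ for $A\in\mathscr O(X)\cup\mathscr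 K(X)$ and $(q^*\nu)(F)=\inf\{\nu(q(U)):F\subseteq U,\ U\in\mathscr O(X)\}$ for all other closed $F$; $i_Y(y)=\delta_y$ is the point mass at $y$. A map $w:Y\to X^\flat$ (resp. $w:Y\to X^\sharp$) is *k-proper* if $w^{-1}(K^\flat)$ (resp. $w^{-1}(K^\sharp)$) is compact for every $K\in\mathscr K(X)$. **Theorem.** Let $X$ and $Y$ be locally compact Hausdorff spaces. (I) If $q$ is a d-image transformation (resp. an image transformation) from $X$ to $Y$, then $w=q^*\circ i_Y$ takes its values in $X^\flat$ (resp. $X^\sharp$), it is continuous and k-proper, and $q=w^{-1}\circ\Lambda$. (II) If $w:Y\to X^\flat$ (resp. $w:Y\to X^\sharp$) is continuous and k-proper, then $q=w^{-1}\circ\Lambda$ is a d-image transformation (resp. an image transformation) from $X$ to $Y$, and $w=q^*\circ i_Y$. Thus $q\mapsto q^*\circ i_Y$ is a bijection, with inverse $w\mapsto w^{-1}\circ\Lambda$, from the d-image transformations (resp. image transformations) from $X$ to $Y$ onto the continuous k-proper maps $Y\to X^\flat$ (resp. $Y\to X^\sharp$). In this bijection $q$ is not identically $\emptyset$ if and only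 if $w$ is not identically the zero set function. -/

import Mathlib

open scoped ENNReal ZeroAtInfty Topology

/-- The family of all sets that are open or closed. -/
abbrev OpenOrClosed (X : Type*) [TopologicalSpace X] : Type _ :=
  {A : Set X // IsOpen A ∨ IsClosed A}

/-- The family of all sets that are open or compact. -/
abbrev OpenOrCompact (X : Type*) [TopologicalSpace X] : Type _ :=
  {A : Set X // IsOpen A ∨ IsCompact A}

/-- In a Hausdorff space, an open or compact set is open or closed. -/
def OpenOrCompact.toOpenOrClosed {X : Type*} [TopologicalSpace X] [T2Space X]
    (A : OpenOrCompact X) : OpenOrClosed X :=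
  ⟨A.1, A.2.imp id IsCompact.isClosed⟩

/-- The whole space as an open set. -/
def OpenOrClosed.whole (X : Type*) [TopologicalSpace X] : OpenOrClosed X :=
  ⟨Set.univ, Or.inl isOpen_univ⟩

/-- A topological measure: a `[0, ∞]`-valued function on the open and the closed sets, not
identically `∞`, additive on disjoint open or compact sets whose union is open or compact, inner
regular on open sets and outer regular on closed sets. -/
structure IsTopologicalMeasure {X : Type*} [TopologicalSpace X]
    (μ : OpenOrClosed X → ℝ≥0∞) : Prop where
  exists_ne_top : ∃ A, μ A ≠ ∞
  add : ∀ A B C : OpenOrClosed X,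
    (IsOpen A.1 ∨ IsCompact A.1) → (IsOpen B.1 ∨ IsCompact B.1) → (IsOpen C.1 ∨ IsCompact C.1) →
    Disjoint A.1 B.1 → C.1 = A.1 ∪ B.1 → μ C = μ A + μ B
  inner : ∀ U : OpenOrClosed X, IsOpen U.1 →
    μ U = ⨆ (K : OpenOrClosed X) (_ : IsCompact K.1 ∧ K.1 ⊆ U.1), μ K
  outer : ∀ F : OpenOrClosed X, IsClosed F.1 →
    μ F = ⨅ (U : OpenOrClosed X) (_ : IsOpen U.1 ∧ F.1 ⊆ U.1), μ U

/-- A deficient topological measure: additivity is only required for disjoint compact sets. -/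
structure IsDeficientTopologicalMeasure {X : Type*} [TopologicalSpace X]
    (μ : OpenOrClosed X → ℝ≥0∞) : Prop where
  exists_ne_top : ∃ A, μ A ≠ ∞
  add : ∀ A B C : OpenOrClosed X, IsCompact A.1 → IsCompact B.1 →
    Disjoint A.1 B.1 → C.1 = A.1 ∪ B.1 → μ C = μ A + μ B
  inner : ∀ U : OpenOrClosed X, IsOpen U.1 →
    μ U = ⨆ (K : OpenOrClosed X) (_ : IsCompact K.1 ∧ K.1 ⊆ U.1), μ K
  outer : ∀ F : OpenOrClosed X, IsClosed F.1 →
    μ F = ⨅ (U : OpenOrClosed X) (_ : IsOpen U.1 ∧ F.1 ⊆ U.1), μ U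

theorem IsTopologicalMeasure.deficient {X : Type*} [TopologicalSpace X]
    {μ : OpenOrClosed X → ℝ≥0∞} (h : IsTopologicalMeasure μ) :
    IsDeficientTopologicalMeasure μ where
  exists_ne_top := h.exists_ne_top
  add A B C hA hB hd hC :=
    h.add A B C (Or.inr hA) (Or.inr hB) (Or.inr (hC ▸ hA.union hB)) hd hC
  inner := h.inner
  outer := h.outer

/-- The space `𝐃𝐓𝐌(X)` of all finite deficient topological measures on `X`. -/
def FiniteDTM (X : Type*) [TopologicalSpace X] : Type _ :=
  {μ : OpenOrClosed X → ℝ≥0∞ // IsDeficientTopologicalMeasure μ ∧ μ (OpenOrClosed.whole X) ≠ ∞}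

/-- The cone `C₀⁺(X)` of nonnegative continuous functions vanishing at infinity. -/
abbrev NonnegC0 (X : Type*) [TopologicalSpace X] : Type _ :=
  {f : C₀(X, ℝ) // ∀ x, 0 ≤ f x}

/-- The quasi-integral `∫ f dμ = ∫₀ᵇ μ({x : f x > t}) dt` of `f ∈ C₀⁺(X)`, where `[0, b]`
contains the range of `f`; here `b = ‖f‖`. -/
noncomputable def quasiIntegral {X : Type*} [TopologicalSpace X] (μ : FiniteDTM X)
    (f : NonnegC0 X) : ℝ :=
  ∫ t in (0 : ℝ)..‖f.1‖,
    (μ.1 ⟨{x | t < f.1 x}, Or.inl (isOpen_lt continuous_const (map_continuous f.1))⟩).toReal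

/-- The weak topology: the coarsest one making all `μ ↦ ∫ f dμ`, `f ∈ C₀⁺(X)`, continuous. -/
noncomputable instance FiniteDTM.instTopologicalSpace (X : Type*) [TopologicalSpace X] :
    TopologicalSpace (FiniteDTM X) :=
  ⨅ f : NonnegC0 X, TopologicalSpace.induced (fun μ => quasiIntegral μ f) inferInstance

/-- A set function is simple if it only assumes the values `0` and `1`. -/
def IsSimpleSetFunction {X : Type*} [TopologicalSpace X] (μ : OpenOrClosed X → ℝ≥0∞) : Prop :=
  ∀ A, μ A = 0 ∨ μ A = 1

/-- The set `X^♭` of simple deficient topological measures on `X`, a subspace of `𝐃𝐓𝐌(X)`. -/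
def SimpleDTM (X : Type*) [TopologicalSpace X] : Set (FiniteDTM X) :=
  {μ | IsSimpleSetFunction μ.1}

/-- The set `X^♯` of simple topological measures on `X`, a subspace of `𝐃𝐓𝐌(X)`. -/
def SimpleTM (X : Type*) [TopologicalSpace X] : Set (FiniteDTM X) :=
  {μ | IsTopologicalMeasure μ.1 ∧ IsSimpleSetFunction μ.1}

/-- The map `Λ : A ↦ {μ ∈ S : μ(A) = 1}` on open or compact sets. For `S = X^♭` it is the basic
d-image transformation `A ↦ A^♭`, for `S = X^♯` the basic image transformation `A ↦ A^♯`. -/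
def basicTransformation {X : Type*} [TopologicalSpace X] [T2Space X] (S : Set (FiniteDTM X))
    (A : OpenOrCompact X) : Set S :=
  {μ | μ.1.1 A.toOpenOrClosed = 1}

/-- For `S = X^♭` or `S = X^♯`, a map `w : Y → S` is k-proper if the preimage of `K^♭`
(resp. `K^♯`) is compact for every compact `K ⊆ X`. -/
def IsKProper {X Y : Type*} [TopologicalSpace X] [T2Space X] [TopologicalSpace Y]
    {S : Set (FiniteDTM X)} (w : Y → S) : Prop :=
  ∀ K : OpenOrCompact X, IsCompact K.1 → IsCompact (w ⁻¹' basicTransformation S K)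

/-- A d-image transformation from `X` to `Y`. -/
structure IsDImageTransformation {X Y : Type*} [TopologicalSpace X] [TopologicalSpace Y]
    (q : OpenOrCompact X → OpenOrCompact Y) : Prop where
  isOpen : ∀ U : OpenOrCompact X, IsOpen U.1 → IsOpen (q U).1
  isCompact : ∀ K : OpenOrCompact X, IsCompact K.1 → IsCompact (q K).1
  inner : ∀ U : OpenOrCompact X, IsOpen U.1 →
    (q U).1 = ⋃ (K : OpenOrCompact X) (_ : IsCompact K.1 ∧ K.1 ⊆ U.1), (q K).1
  outer : ∀ K : OpenOrCompact X, IsCompact K.1 →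
    (q K).1 = ⋂ (U : OpenOrCompact X) (_ : IsOpen U.1 ∧ K.1 ⊆ U.1), (q U).1
  disjoint_union : ∀ A B C : OpenOrCompact X, IsCompact A.1 → IsCompact B.1 →
    Disjoint A.1 B.1 → C.1 = A.1 ∪ B.1 →
    Disjoint (q A).1 (q B).1 ∧ (q C).1 = (q A).1 ∪ (q B).1

/-- An image transformation from `X` to `Y`: here disjoint unions are preserved for all open or
compact sets whose union is again open or compact. -/
structure IsImageTransformation {X Y : Type*} [TopologicalSpace X] [TopologicalSpace Y]
    (q : OpenOrCompact X → OpenOrCompact Y) : Prop where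
  isOpen : ∀ U : OpenOrCompact X, IsOpen U.1 → IsOpen (q U).1
  isCompact : ∀ K : OpenOrCompact X, IsCompact K.1 → IsCompact (q K).1
  inner : ∀ U : OpenOrCompact X, IsOpen U.1 →
    (q U).1 = ⋃ (K : OpenOrCompact X) (_ : IsCompact K.1 ∧ K.1 ⊆ U.1), (q K).1
  outer : ∀ K : OpenOrCompact X, IsCompact K.1 →
    (q K).1 = ⋂ (U : OpenOrCompact X) (_ : IsOpen U.1 ∧ K.1 ⊆ U.1), (q U).1
  disjoint_union : ∀ A B C : OpenOrCompact X,
    Disjoint A.1 B.1 → C.1 = A.1 ∪ B.1 →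
    Disjoint (q A).1 (q B).1 ∧ (q C).1 = (q A).1 ∪ (q B).1

open Classical in
/-- The adjoint `q^*`: `(q^* ν)(A) = ν(q(A))` for `A` open or compact, and
`(q^* ν)(F) = inf {(q^* ν)(U) : U open, F ⊆ U}` for the remaining closed sets `F`. -/
noncomputable def imageAdjoint {X Y : Type*} [TopologicalSpace X] [TopologicalSpace Y] [T2Space Y]
    (q : OpenOrCompact X → OpenOrCompact Y) (ν : OpenOrClosed Y → ℝ≥0∞) :
    OpenOrClosed X → ℝ≥0∞ := fun A =>
  if hA : IsOpen A.1 ∨ IsCompact A.1 then ν (q ⟨A.1, hA⟩).toOpenOrClosed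
  else ⨅ (U : OpenOrCompact X) (_ : IsOpen U.1 ∧ A.1 ⊆ U.1), ν (q U).toOpenOrClosed

open Classical in
/-- The set function `A ↦ 1` if `y ∈ A`, and `A ↦ 0` otherwise. -/
noncomputable def pointMassFun {Y : Type*} [TopologicalSpace Y] (y : Y) :
    OpenOrClosed Y → ℝ≥0∞ := fun A => if y ∈ A.1 then 1 else 0

theorem isTopologicalMeasure_pointMassFun {Y : Type*} [TopologicalSpace Y] [T2Space Y] (y : Y) :
    IsTopologicalMeasure (pointMassFun y) where
  exists_ne_top := ⟨OpenOrClosed.whole Y, by simp [pointMassFun, OpenOrClosed.whole]⟩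
  add A B C _ _ _ hd hC := by
    have hd' : y ∈ A.1 → y ∉ B.1 := fun h => Set.disjoint_left.1 hd h
    by_cases hA : y ∈ A.1
    · simp [pointMassFun, hC, hA, hd' hA]
    · have hCB : y ∈ C.1 ↔ y ∈ B.1 := by simp [hC, hA]
      by_cases hB : y ∈ B.1 <;> simp [pointMassFun, hCB, hA, hB]
  inner U _ := by
    apply le_antisymm
    · by_cases hU : y ∈ U.1
      · refine le_trans (le_of_eq ?_) (le_iSup₂ (f := fun (K : OpenOrClosed Y)
          (_ : IsCompact K.1 ∧ K.1 ⊆ U.1) => pointMassFun y K)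
          ⟨{y}, Or.inr isClosed_singleton⟩ ⟨isCompact_singleton, by simpa using hU⟩)
        simp [pointMassFun, hU]
      · simp [pointMassFun, hU]
    · refine iSup₂_le fun K hK => ?_
      by_cases hy : y ∈ K.1
      · simp [pointMassFun, hy, hK.2 hy]
      · simp [pointMassFun, hy]
  outer F _ := by
    apply le_antisymm
    · refine le_iInf₂ fun U hU => ?_
      by_cases hy : y ∈ F.1
      · simp [pointMassFun, hy, hU.2 hy]
      · simp [pointMassFun, hy]
    · by_cases hF : y ∈ F.1
      · refine le_trans (iInf₂_le (OpenOrClosed.whole Y) ⟨isOpen_univ, Set.subset_univ _⟩) ?_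
        simp [pointMassFun, hF, OpenOrClosed.whole]
      · refine le_trans (iInf₂_le ⟨{y}ᶜ, Or.inl isOpen_compl_singleton⟩
          ⟨isOpen_compl_singleton, fun z hz hzy => hF (hzy ▸ hz)⟩) ?_
        simp [pointMassFun]

/-- The map `i_Y : Y → 𝐃𝐓𝐌(Y)`, `y ↦ δ_y`. -/
noncomputable def pointMass {Y : Type*} [TopologicalSpace Y] [T2Space Y] (y : Y) : FiniteDTM Y :=
  ⟨pointMassFun y, (isTopologicalMeasure_pointMassFun y).deficient,
    by simp [pointMassFun, OpenOrClosed.whole]⟩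

/-! ### Simple deficient topological measures and their weak topology. -/

section SimpleMeasures

variable {X : Type*} [TopologicalSpace X]

/-! The relation `y ∈ q A ↔ w y A = 1` makes a transformation `q` and a map `w` two descriptions of
the same data. With `y` fixed, regularity and disjoint additivity of `q` are exactly regularity and
additivity of a set function with values `0` and `1`; closed sets that are neither open nor compact
are governed by outer regularity.

What remains is topology: openness and compactness of the sets `q A` against continuity and
k-properness of `w`. Compactness is k-properness verbatim. For openness, `lt_quasiIntegral_iff`
computes the integral of `f` against a simple measure as the threshold of `t` up to which `{f > t}`
has measure `1`. Hence `{μ | μ U = 1}` is weakly open, by Urysohn functions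
(`isOpen_basicTransformation`), so continuity of `w` makes `q U` open. Conversely, strict superlevel
sets of `y ↦ ∫ f d(w y)` are unions of open sets `q {f > t}`, and weak ones are intersections of
compact sets `q {f ≥ t}`, which gives continuity (`IsDImageTransformation.continuous`). -/

theorem IsDeficientTopologicalMeasure.le_of_isClosed_isOpen {μ : OpenOrClosed X → ℝ≥0∞}
    (h : IsDeficientTopologicalMeasure μ) {F U : OpenOrClosed X} (hF : IsClosed F.1)
    (hU : IsOpen U.1) (hFU : F.1 ⊆ U.1) : μ F ≤ μ U := by
  rw [h.outer F hF]
  exact iInf₂_le U ⟨hU, hFU⟩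

theorem IsSimpleSetFunction.le_one {μ : OpenOrClosed X → ℝ≥0∞} (hs : IsSimpleSetFunction μ)
    (A : OpenOrClosed X) : μ A ≤ 1 := by
  rcases hs A with h | h <;> simp [h]

theorem IsSimpleSetFunction.eq_one_of_le {μ : OpenOrClosed X → ℝ≥0∞}
    (hs : IsSimpleSetFunction μ) {A : OpenOrClosed X} (h : 1 ≤ μ A) : μ A = 1 :=
  le_antisymm (hs.le_one A) h

theorem IsDeficientTopologicalMeasure.empty {μ : OpenOrClosed X → ℝ≥0∞}
    (h : IsDeficientTopologicalMeasure μ) (hs : IsSimpleSetFunction μ) {A : OpenOrClosed X}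
    (hA : A.1 = ∅) : μ A = 0 := by
  have hc : IsCompact A.1 := hA ▸ isCompact_empty
  have := h.add A A A hc hc (by simp [hA]) (by simp)
  rcases hs A with h0 | h1
  · exact h0
  · rw [h1] at this
    norm_num at this

/-- A supremum of zeros and ones that equals `1` is attained, so inner regularity yields an actual
compact set; the next lemma is the dual for outer regularity. -/
theorem IsDeficientTopologicalMeasure.exists_isCompact_eq_one {μ : OpenOrClosed X → ℝ≥0∞}
    (h : IsDeficientTopologicalMeasure μ) (hs : IsSimpleSetFunction μ) {U : OpenOrClosed X}
    (hU : IsOpen U.1) (h1 : μ U = 1) :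
    ∃ K : OpenOrClosed X, (IsCompact K.1 ∧ K.1 ⊆ U.1) ∧ μ K = 1 := by
  by_contra! hne
  have : μ U ≤ 0 := by
    rw [h.inner U hU]
    exact iSup₂_le fun K hK => ((hs K).resolve_right (hne K hK)).le
  simp [h1] at this

theorem IsDeficientTopologicalMeasure.exists_isOpen_eq_zero {μ : OpenOrClosed X → ℝ≥0∞}
    (h : IsDeficientTopologicalMeasure μ) (hs : IsSimpleSetFunction μ) {F : OpenOrClosed X}
    (hF : IsClosed F.1) (h0 : μ F = 0) :
    ∃ U : OpenOrClosed X, (IsOpen U.1 ∧ F.1 ⊆ U.1) ∧ μ U = 0 := by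
  by_contra! hne
  have : 1 ≤ μ F := by
    rw [h.outer F hF]
    exact le_iInf₂ fun U hU => ((hs U).resolve_left (hne U hU)).ge
  simp [h0] at this

/-- The open set `{f > t}`. -/
def superlevel (f : NonnegC0 X) (t : ℝ) : OpenOrClosed X :=
  ⟨{x | t < f.1 x}, Or.inl (isOpen_lt continuous_const (map_continuous f.1))⟩

theorem quasiIntegral_nonneg (μ : FiniteDTM X) (f : NonnegC0 X) : 0 ≤ quasiIntegral μ f :=
  intervalIntegral.integral_nonneg (norm_nonneg _) fun _ _ => ENNReal.toReal_nonneg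

theorem continuous_quasiIntegral (f : NonnegC0 X) :
    Continuous fun μ : FiniteDTM X => quasiIntegral μ f :=
  continuous_iff_le_induced.2 (iInf_le _ f)

variable [T2Space X]

/-- Monotonicity is not an axiom. It follows by squeezing: shrink an open `A` to compact sets,
enlarge a closed `B` to open sets, and compare closed with open by outer regularity. -/
theorem IsDeficientTopologicalMeasure.mono {μ : OpenOrClosed X → ℝ≥0∞}
    (h : IsDeficientTopologicalMeasure μ) {A B : OpenOrClosed X} (hAB : A.1 ⊆ B.1) :
    μ A ≤ μ B := by
  rcases B.2 with hB | hB
  · rcases A.2 with hA | hA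
    · rw [h.inner A hA]
      exact iSup₂_le fun K hK =>
        h.le_of_isClosed_isOpen hK.1.isClosed hB (hK.2.trans hAB)
    · exact h.le_of_isClosed_isOpen hA hB hAB
  · rw [h.outer B hB]
    refine le_iInf₂ fun U hU => ?_
    rcases A.2 with hA | hA
    · rw [h.inner A hA]
      exact iSup₂_le fun K hK =>
        h.le_of_isClosed_isOpen hK.1.isClosed hU.1 (hK.2.trans (hAB.trans hU.2))
    · exact h.le_of_isClosed_isOpen hA hU.1 (hAB.trans hU.2)

/-- The integrand is antitone with values `0` and `1`, so the integral is the length of the initial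
interval on which it equals `1`. -/
theorem lt_quasiIntegral_iff {μ : FiniteDTM X} (hμ : μ ∈ SimpleDTM X) (f : NonnegC0 X) {s : ℝ}
    (hs : 0 ≤ s) : s < quasiIntegral μ f ↔ ∃ t, s < t ∧ μ.1 (superlevel f t) = 1 := by
  set g : ℝ → ℝ := fun t => (μ.1 (superlevel f t)).toReal with hg
  have hq : quasiIntegral μ f = ∫ t in (0 : ℝ)..‖f.1‖, g t := rfl
  have hsimple : IsSimpleSetFunction μ.1 := hμ
  have hanti : Antitone g := fun t u htu =>
    ENNReal.toReal_mono (ne_top_of_le_ne_top ENNReal.one_ne_top (hsimple.le_one _))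
      (μ.2.1.mono fun x hx => lt_of_le_of_lt htu hx)
  have hint : ∀ a b, IntervalIntegrable g MeasureTheory.volume a b := fun a b =>
    hanti.intervalIntegrable
  have h0 : ∀ t, 0 ≤ g t := fun t => ENNReal.toReal_nonneg
  have h1 : ∀ t, g t ≤ 1 := fun t => by
    rcases hsimple (superlevel f t) with h | h <;> simp [hg, h]
  have hle : ∀ a b : ℝ, a ≤ b → ∫ t in a..b, g t ≤ b - a := fun a b hab => by
    calc ∫ t in a..b, g t ≤ ∫ _ in a..b, (1 : ℝ) :=
          intervalIntegral.integral_mono_on hab (hint a b) (by simp) fun t _ => h1 t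
      _ = b - a := by simp
  have hb : 0 ≤ ‖f.1‖ := norm_nonneg _
  rw [hq]
  constructor
  · intro hlt
    by_contra! hne
    rcases le_total ‖f.1‖ s with hbs | hsb
    · linarith [hle 0 _ hb]
    · have hz : ∫ t in s..‖f.1‖, g t = 0 := by
        rw [intervalIntegral.integral_congr_ae (g := fun _ => 0)]
        · simp
        · refine Filter.Eventually.of_forall fun t ht => ?_
          rw [Set.uIoc_of_le hsb] at ht
          simp [hg, (hsimple _).resolve_right (hne t ht.1)]
      rw [← intervalIntegral.integral_add_adjacent_intervals (hint 0 s) (hint s _), hz] at hlt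
      linarith [hle 0 s hs]
  · rintro ⟨t, hst, ht⟩
    have ht0 : 0 ≤ t := hs.trans hst.le
    -- For `t ≥ ‖f‖` the superlevel set is empty, hence has measure `0`.
    have htb : t < ‖f.1‖ := by
      by_contra! hbt
      have : μ.1 (superlevel f t) = 0 := μ.2.1.empty hsimple <| by
        ext x
        simp only [superlevel, Set.mem_ofPred_eq, Set.mem_empty_iff_false, iff_false, not_lt]
        have := BoundedContinuousFunction.norm_coe_le_norm f.1.toBCF x
        exact (le_abs_self _).trans (this.trans hbt)
      simp [this] at ht
    rw [← intervalIntegral.integral_add_adjacent_intervals (hint 0 t) (hint t _)]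
    have hone : ∫ u in (0 : ℝ)..t, (1 : ℝ) ≤ ∫ u in (0 : ℝ)..t, g u :=
      intervalIntegral.integral_mono_on ht0 (by simp) (hint 0 t) fun u hu => by
        have : g t = 1 := by simp [hg, ht]
        exact this ▸ hanti hu.2
    have hrest : 0 ≤ ∫ u in t..‖f.1‖, g u :=
      intervalIntegral.integral_nonneg htb.le fun u _ => h0 u
    simp at hone
    linarith

/-- Urysohn's lemma gives `f` equal to `1` on a compact `K ⊆ U` of measure `1` and to `0` off `U`.
Then `0 < ∫ f dν` is a weakly open condition that holds at `μ` and forces `ν U = 1`. -/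
theorem isOpen_basicTransformation [LocallyCompactSpace X] {S : Set (FiniteDTM X)}
    (hS : S ⊆ SimpleDTM X) {U : OpenOrCompact X} (hU : IsOpen U.1) :
    IsOpen (basicTransformation S U) := by
  rw [isOpen_iff_mem_nhds]
  rintro ⟨μ, hμ⟩ (hμU : μ.1 U.toOpenOrClosed = 1)
  obtain ⟨K, ⟨hKc, hKU⟩, hK1⟩ := μ.2.1.exists_isCompact_eq_one (hS hμ) hU hμU
  obtain ⟨g, hgK, hgU, hgc, hg01⟩ := exists_continuous_one_zero_of_isCompact hKc hU.isClosed_compl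
    (Set.disjoint_compl_right_iff_subset.2 hKU)
  let f : NonnegC0 X := ⟨⟨g, hgc.is_zero_at_infty⟩, fun x => (hg01 x).1⟩
  have hopen : IsOpen {ν : S | 0 < quasiIntegral ν.1 f} :=
    isOpen_lt continuous_const ((continuous_quasiIntegral f).comp continuous_subtype_val)
  refine Filter.mem_of_superset (hopen.mem_nhds ?_) ?_
  -- Any level in `(0, 1)` would do: `K` lies in `{f > 1/2}`.
  · refine (lt_quasiIntegral_iff (hS hμ) f le_rfl).2 ⟨1 / 2, by norm_num, ?_⟩
    refine IsSimpleSetFunction.eq_one_of_le (hS hμ) (hK1 ▸ μ.2.1.mono fun x hx => ?_)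
    change 1 / 2 < g x
    rw [hgK hx]
    norm_num
  · rintro ν hν
    obtain ⟨t, ht0, ht⟩ := (lt_quasiIntegral_iff (hS ν.2) f le_rfl).1 hν
    refine IsSimpleSetFunction.eq_one_of_le (hS ν.2) (ht ▸ ν.1.2.1.mono fun x hx => ?_)
    by_contra hxU
    have hx' : t < g x := hx
    rw [hgU hxU] at hx'
    exact lt_asymm ht0 hx'

/-- Since values never exceed `1`, additivity excludes that both parts have measure `1`; this gives
disjointness of the preimages. -/
theorem preimage_disjoint_union {Y : Type*} {S : Set (FiniteDTM X)} (hS : S ⊆ SimpleDTM X) (w : Y → S)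
    {A B C : OpenOrCompact X}
    (h : ∀ y, (w y).1.1 C.toOpenOrClosed =
      (w y).1.1 A.toOpenOrClosed + (w y).1.1 B.toOpenOrClosed) :
    Disjoint (w ⁻¹' basicTransformation S A) (w ⁻¹' basicTransformation S B) ∧
      w ⁻¹' basicTransformation S C =
        w ⁻¹' basicTransformation S A ∪ w ⁻¹' basicTransformation S B := by
  have key : ∀ y, ¬ ((w y).1.1 A.toOpenOrClosed = 1 ∧ (w y).1.1 B.toOpenOrClosed = 1) := by
    rintro y ⟨hA, hB⟩
    have h2 := h y
    have hC := IsSimpleSetFunction.le_one (hS (w y).2) C.toOpenOrClosed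
    rw [h2, hA, hB] at hC
    norm_num at hC
  refine ⟨Set.disjoint_left.2 fun y hA hB => key y ⟨hA, hB⟩, ?_⟩
  ext y
  change (w y).1.1 C.toOpenOrClosed = 1 ↔
    ((w y).1.1 A.toOpenOrClosed = 1 ∨ (w y).1.1 B.toOpenOrClosed = 1)
  rw [h y]
  have hk := key y
  rcases hS (w y).2 A.toOpenOrClosed with hA | hA <;>
    rcases hS (w y).2 B.toOpenOrClosed with hB | hB <;> simp_all

end SimpleMeasures

/-! ### Monotonicity of transformations, and the passage from `w` to `q`. -/

section Transformations

variable {X Y : Type*} [TopologicalSpace X] [TopologicalSpace Y]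

theorem IsImageTransformation.isDImageTransformation {q : OpenOrCompact X → OpenOrCompact Y}
    (hq : IsImageTransformation q) : IsDImageTransformation q where
  isOpen := hq.isOpen
  isCompact := hq.isCompact
  inner := hq.inner
  outer := hq.outer
  disjoint_union A B C _ _ := hq.disjoint_union A B C

namespace IsDImageTransformation

variable {q : OpenOrCompact X → OpenOrCompact Y}

theorem subset_of_isCompact_isOpen (hq : IsDImageTransformation q) {K U : OpenOrCompact X}
    (hK : IsCompact K.1) (hU : IsOpen U.1) (h : K.1 ⊆ U.1) : (q K).1 ⊆ (q U).1 := by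
  rw [hq.inner U hU]
  exact Set.subset_iUnion₂_of_subset K ⟨hK, h⟩ subset_rfl

theorem mono (hq : IsDImageTransformation q) {A B : OpenOrCompact X} (h : A.1 ⊆ B.1) :
    (q A).1 ⊆ (q B).1 := by
  rcases B.2 with hB | hB
  · rcases A.2 with hA | hA
    · rw [hq.inner A hA]
      exact Set.iUnion₂_subset fun K hK => hq.subset_of_isCompact_isOpen hK.1 hB (hK.2.trans h)
    · exact hq.subset_of_isCompact_isOpen hA hB h
  · rw [hq.outer B hB]
    refine Set.subset_iInter₂ fun U hU => ?_
    rcases A.2 with hA | hA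
    · rw [hq.inner A hA]
      exact Set.iUnion₂_subset fun K hK =>
        hq.subset_of_isCompact_isOpen hK.1 hU.1 (hK.2.trans (h.trans hU.2))
    · exact hq.subset_of_isCompact_isOpen hA hU.1 (h.trans hU.2)

end IsDImageTransformation

open Classical in
theorem imageAdjoint_pointMass_apply [T2Space X] [T2Space Y]
    (q : OpenOrCompact X → OpenOrCompact Y) (y : Y) {A : OpenOrClosed X}
    (hA : IsOpen A.1 ∨ IsCompact A.1) :
    imageAdjoint q (pointMass y).1 A = if y ∈ (q ⟨A.1, hA⟩).1 then 1 else 0 := by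
  rw [imageAdjoint, dif_pos hA]
  rfl

/-- Stated for any `S` inside `SimpleDTM X`, so that it also supplies every axiom but full
additivity in the case of `SimpleTM X`. -/
theorem isDImageTransformation_of_eq_preimage [T2Space X] [LocallyCompactSpace X] {S : Set (FiniteDTM X)}
    (hS : S ⊆ SimpleDTM X) {w : Y → S} (hc : Continuous w) (hk : IsKProper w)
    {q : OpenOrCompact X → OpenOrCompact Y}
    (hq : ∀ A, (q A).1 = w ⁻¹' basicTransformation S A) : IsDImageTransformation q where
  isOpen U hU := hq U ▸ (isOpen_basicTransformation hS hU).preimage hc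
  isCompact K hK := hq K ▸ hk K hK
  inner U hU := by
    refine Set.Subset.antisymm (fun y hy => ?_) (Set.iUnion₂_subset fun K hK y hy => ?_)
    · rw [hq] at hy
      obtain ⟨K, hK, h1⟩ := (w y).1.2.1.exists_isCompact_eq_one (hS (w y).2) hU hy
      refine Set.mem_iUnion₂.2 ⟨⟨K.1, Or.inr hK.1⟩, hK, ?_⟩
      rw [hq]
      exact h1
    · rw [hq] at hy ⊢
      have hy1 : (w y).1.1 K.toOpenOrClosed = 1 := hy
      exact IsSimpleSetFunction.eq_one_of_le (hS (w y).2) (hy1 ▸ (w y).1.2.1.mono hK.2)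
  outer K hK := by
    refine Set.Subset.antisymm (Set.subset_iInter₂ fun U hU y hy => ?_) (fun y hy => ?_)
    · rw [hq] at hy ⊢
      have hy1 : (w y).1.1 K.toOpenOrClosed = 1 := hy
      exact IsSimpleSetFunction.eq_one_of_le (hS (w y).2) (hy1 ▸ (w y).1.2.1.mono hU.2)
    · rw [hq]
      by_contra hne
      obtain ⟨U, hU, h0⟩ := (w y).1.2.1.exists_isOpen_eq_zero (hS (w y).2)
        (F := K.toOpenOrClosed) hK.isClosed ((hS (w y).2 _).resolve_right hne)
      have h1 := Set.mem_iInter₂.1 hy ⟨U.1, Or.inl hU.1⟩ hU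
      rw [hq] at h1
      exact zero_ne_one (h0.symm.trans h1)
  disjoint_union A B C hA hB hd hC := by
    rw [hq, hq, hq]
    exact preimage_disjoint_union hS w fun y => (w y).1.2.1.add _ _ _ hA hB hd hC

theorem isImageTransformation_of_eq_preimage [T2Space X] [LocallyCompactSpace X]
    {w : Y → SimpleTM X} (hc : Continuous w) (hk : IsKProper w)
    {q : OpenOrCompact X → OpenOrCompact Y}
    (hq : ∀ A, (q A).1 = w ⁻¹' basicTransformation (SimpleTM X) A) :
    IsImageTransformation q :=
  have hd := isDImageTransformation_of_eq_preimage (fun _ h => h.2) hc hk hq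
  { isOpen := hd.isOpen
    isCompact := hd.isCompact
    inner := hd.inner
    outer := hd.outer
    disjoint_union := fun A B C hAB hC => by
      rw [hq, hq, hq]
      exact preimage_disjoint_union (fun _ h => h.2) w fun y =>
        (w y).2.1.add _ _ _ A.2 B.2 C.2 hAB hC }

/-! ### The adjoint at a point mass, and the passage from `q` to `w`. -/

variable [T2Space X] [T2Space Y]

theorem imageAdjoint_pointMass_toOpenOrClosed_eq_one_iff
    (q : OpenOrCompact X → OpenOrCompact Y) (y : Y) (A : OpenOrCompact X) :
    imageAdjoint q (pointMass y).1 A.toOpenOrClosed = 1 ↔ y ∈ (q A).1 := by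
  classical
  rw [imageAdjoint_pointMass_apply q y (A := A.toOpenOrClosed) A.2]
  change (if y ∈ (q A).1 then (1 : ℝ≥0∞) else 0) = 1 ↔ _
  simp

theorem isSimpleSetFunction_imageAdjoint_pointMass (q : OpenOrCompact X → OpenOrCompact Y)
    (y : Y) : IsSimpleSetFunction (imageAdjoint q (pointMass y).1) := by
  classical
  intro A
  by_cases hA : IsOpen A.1 ∨ IsCompact A.1
  · rw [imageAdjoint_pointMass_apply q y hA]
    split_ifs <;> simp
  · rw [imageAdjoint, dif_neg hA]
    by_cases h : ∃ U : OpenOrCompact X, (IsOpen U.1 ∧ A.1 ⊆ U.1) ∧ y ∉ (q U).1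
    · obtain ⟨U, hU, hy⟩ := h
      refine Or.inl (le_antisymm ((iInf₂_le U hU).trans (le_of_eq ?_)) zero_le)
      exact if_neg hy
    · push Not at h
      refine Or.inr (le_antisymm ?_ (le_iInf₂ fun U hU => ?_))
      -- The whole space is among the competitors, so the infimum is not the empty one, `∞`.
      · refine (iInf₂_le (⟨Set.univ, Or.inl isOpen_univ⟩ : OpenOrCompact X)
          ⟨isOpen_univ, Set.subset_univ _⟩).trans (le_of_eq ?_)
        exact if_pos (h _ ⟨isOpen_univ, Set.subset_univ _⟩)
      · exact (if_pos (h U hU) : (if y ∈ (q U).1 then (1 : ℝ≥0∞) else 0) = 1).ge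

theorem IsDImageTransformation.imageAdjoint_pointMass {q : OpenOrCompact X → OpenOrCompact Y}
    (hq : IsDImageTransformation q) (y : Y) :
    IsDeficientTopologicalMeasure (imageAdjoint q (pointMass y).1) := by
  classical
  have happ := fun A hA => imageAdjoint_pointMass_apply q y (A := A) hA
  refine ⟨⟨OpenOrClosed.whole X, ?_⟩, ?_, ?_, ?_⟩
  · rcases isSimpleSetFunction_imageAdjoint_pointMass q y (OpenOrClosed.whole X) with h | h <;>
      simp [h]
  · intro A B C hA hB hd hC
    have hCc : IsCompact C.1 := hC ▸ hA.union hB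
    obtain ⟨hd', hu⟩ := hq.disjoint_union ⟨A.1, Or.inr hA⟩ ⟨B.1, Or.inr hB⟩ ⟨C.1, Or.inr hCc⟩
      hA hB hd hC
    rw [happ A (Or.inr hA), happ B (Or.inr hB), happ C (Or.inr hCc), hu]
    have : y ∈ (q ⟨A.1, _⟩).1 → y ∉ (q ⟨B.1, _⟩).1 := fun h => Set.disjoint_left.1 hd' h
    by_cases h1 : y ∈ (q ⟨A.1, Or.inr hA⟩).1
    · simp [h1, this h1]
    · simp [h1]
  · intro U hU
    have hmono : ∀ K : OpenOrClosed X, IsCompact K.1 ∧ K.1 ⊆ U.1 →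
        imageAdjoint q (pointMass y).1 K ≤ imageAdjoint q (pointMass y).1 U := fun K hK => by
      rw [happ K (Or.inr hK.1), happ U (Or.inl hU)]
      split_ifs with h1 h2
      · exact le_rfl
      · exact absurd (hq.mono (A := ⟨K.1, Or.inr hK.1⟩) (B := ⟨U.1, Or.inl hU⟩) hK.2 h1) h2
      all_goals simp
    refine le_antisymm ?_ (iSup₂_le hmono)
    rw [happ U (Or.inl hU)]
    split_ifs with h
    · rw [hq.inner _ hU] at h
      obtain ⟨K, hK, hy⟩ := Set.mem_iUnion₂.1 h
      refine le_trans (le_of_eq ?_) (le_iSup₂ (f := fun (K : OpenOrClosed X)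
        (_ : IsCompact K.1 ∧ K.1 ⊆ U.1) => imageAdjoint q (pointMass y).1 K)
          K.toOpenOrClosed hK)
      exact ((imageAdjoint_pointMass_toOpenOrClosed_eq_one_iff q y K).2 hy).symm
    · exact zero_le
  · intro F hF
    by_cases hFA : IsOpen F.1 ∨ IsCompact F.1
    · have hmono : ∀ U : OpenOrClosed X, IsOpen U.1 ∧ F.1 ⊆ U.1 →
          imageAdjoint q (pointMass y).1 F ≤ imageAdjoint q (pointMass y).1 U := fun U hU => by
        rw [happ F hFA, happ U (Or.inl hU.1)]
        split_ifs with h1 h2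
        · exact le_rfl
        · exact absurd (hq.mono (A := ⟨F.1, hFA⟩) (B := ⟨U.1, Or.inl hU.1⟩) hU.2 h1) h2
        all_goals simp
      refine le_antisymm (le_iInf₂ hmono) ?_
      rcases id hFA with hFo | hFc
      · exact iInf₂_le F ⟨hFo, subset_rfl⟩
      · by_cases h : y ∈ (q ⟨F.1, hFA⟩).1
        · refine (iInf₂_le (OpenOrClosed.whole X) ⟨isOpen_univ, Set.subset_univ _⟩).trans ?_
          rw [happ F hFA, if_pos h]
          exact (isSimpleSetFunction_imageAdjoint_pointMass q y).le_one _
        · have h' := h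
          rw [hq.outer _ hFc] at h'
          simp only [Set.mem_iInter₂, not_forall] at h'
          obtain ⟨U, hU, hy⟩ := h'
          refine (iInf₂_le U.toOpenOrClosed hU).trans (le_of_eq ?_)
          rw [happ F hFA, if_neg h]
          exact (isSimpleSetFunction_imageAdjoint_pointMass q y _).resolve_right
            (mt (imageAdjoint_pointMass_toOpenOrClosed_eq_one_iff q y U).1 hy)
    -- Here outer regularity is the definition; only the index types of the two infima differ.
    · conv_lhs => rw [imageAdjoint, dif_neg hFA]
      refine le_antisymm (le_iInf₂ fun U hU => ?_) (le_iInf₂ fun U hU => ?_)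
      · refine (iInf₂_le (⟨U.1, Or.inl hU.1⟩ : OpenOrCompact X) hU).trans (le_of_eq ?_)
        rw [happ U (Or.inl hU.1)]
        rfl
      · refine (iInf₂_le U.toOpenOrClosed hU).trans (le_of_eq ?_)
        rw [happ U.toOpenOrClosed U.2]
        rfl

theorem IsImageTransformation.imageAdjoint_pointMass {q : OpenOrCompact X → OpenOrCompact Y}
    (hq : IsImageTransformation q) (y : Y) :
    IsTopologicalMeasure (imageAdjoint q (pointMass y).1) where
  exists_ne_top := (hq.isDImageTransformation.imageAdjoint_pointMass y).exists_ne_top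
  inner := (hq.isDImageTransformation.imageAdjoint_pointMass y).inner
  outer := (hq.isDImageTransformation.imageAdjoint_pointMass y).outer
  add A B C hA hB hC hd hCe := by
    classical
    obtain ⟨hd', hu⟩ := hq.disjoint_union ⟨A.1, hA⟩ ⟨B.1, hB⟩ ⟨C.1, hC⟩ hd hCe
    rw [imageAdjoint_pointMass_apply q y hA, imageAdjoint_pointMass_apply q y hB,
      imageAdjoint_pointMass_apply q y hC, hu]
    have : y ∈ (q ⟨A.1, _⟩).1 → y ∉ (q ⟨B.1, _⟩).1 := fun h => Set.disjoint_left.1 hd' h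
    by_cases h1 : y ∈ (q ⟨A.1, hA⟩).1
    · simp [h1, this h1]
    · simp [h1]

/-- The set function `q^* δ_y` as an element of `𝐃𝐓𝐌(X)`. -/
noncomputable def IsDImageTransformation.adjointPointMass {q : OpenOrCompact X → OpenOrCompact Y}
    (hq : IsDImageTransformation q) (y : Y) : FiniteDTM X :=
  ⟨imageAdjoint q (pointMass y).1, hq.imageAdjoint_pointMass y,
    ne_top_of_le_ne_top ENNReal.one_ne_top
      ((isSimpleSetFunction_imageAdjoint_pointMass q y).le_one _)⟩

theorem eq_preimage_of_eq_imageAdjoint {q : OpenOrCompact X → OpenOrCompact Y}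
    {S : Set (FiniteDTM X)} {w : Y → S}
    (hw : ∀ y, (w y).1.1 = imageAdjoint q (pointMass y).1) (A : OpenOrCompact X) :
    (q A).1 = w ⁻¹' basicTransformation S A := by
  ext y
  rw [← imageAdjoint_pointMass_toOpenOrClosed_eq_one_iff q y A, ← hw y]
  rfl

/-- The weak topology is initial, so it suffices to treat one `f` at a time, by lower and upper
semicontinuity of `y ↦ ∫ f d(w y)`. -/
theorem IsDImageTransformation.continuous {q : OpenOrCompact X → OpenOrCompact Y}
    (hq : IsDImageTransformation q) {S : Set (FiniteDTM X)} (hS : S ⊆ SimpleDTM X) {w : Y → S}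
    (hw : ∀ y, (w y).1.1 = imageAdjoint q (pointMass y).1) : Continuous w := by
  refine Continuous.subtype_mk (f := fun y => (w y).1) ?_ _
  refine continuous_iInf_rng.2 fun f => continuous_induced_rng.2 ?_
  let U : ℝ → OpenOrCompact X := fun t => ⟨(superlevel f t).1,
    Or.inl (isOpen_lt continuous_const (map_continuous f.1))⟩
  have hUo : ∀ t, IsOpen (U t).1 := fun t => isOpen_lt continuous_const (map_continuous f.1)
  have hlt : ∀ y {s : ℝ}, 0 ≤ s →
      (s < quasiIntegral (w y).1 f ↔ ∃ t, s < t ∧ y ∈ (q (U t)).1) := fun y s hs => by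
    rw [lt_quasiIntegral_iff (hS (w y).2) f hs]
    refine exists_congr fun t => and_congr_right fun _ => ?_
    rw [eq_preimage_of_eq_imageAdjoint hw]
    rfl
  refine continuous_iff_lower_upperSemicontinuous.2 ⟨?_, ?_⟩
  · rw [lowerSemicontinuous_iff_isOpen_preimage]
    intro s
    rcases lt_or_ge s 0 with hs | hs
    · convert isOpen_univ
      exact Set.eq_univ_of_forall fun y => hs.trans_le (quasiIntegral_nonneg _ f)
    · convert isOpen_iUnion fun t => isOpen_iUnion fun (_ : s < t) => hq.isOpen (U t) (hUo t)
      ext y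
      simpa using hlt y hs
  · rw [upperSemicontinuous_iff_isClosed_preimage]
    intro s
    rcases le_or_gt s 0 with hs | hs
    · convert isClosed_univ
      exact Set.eq_univ_of_forall fun y => hs.trans (quasiIntegral_nonneg _ f)
    -- Positivity of `t` matters: `{f ≥ t}` is compact because `f` vanishes at infinity.
    · have hKc : ∀ t : ℝ, 0 < t → IsCompact {x | t ≤ f.1 x} := fun t ht => by
        have hz : ∀ᶠ x in Filter.cocompact X, f.1 x < t :=
          (zero_at_infty f.1).eventually (gt_mem_nhds ht)
        obtain ⟨K, hK, hKs⟩ := Filter.mem_cocompact.1 hz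
        refine hK.of_isClosed_subset (isClosed_le continuous_const (map_continuous f.1))
          fun x hx => ?_
        by_contra hxK
        exact absurd (show f.1 x < t from hKs hxK) (not_lt.2 hx)
      convert isClosed_iInter fun t => isClosed_iInter fun (h : 0 < t ∧ t < s) =>
        (hq.isCompact ⟨{x | t ≤ f.1 x}, Or.inr (hKc t h.1)⟩ (hKc t h.1)).isClosed
      ext y
      simp only [Set.mem_preimage, Set.mem_Ici, Set.mem_iInter]
      constructor
      · rintro h t ⟨ht0, hts⟩
        obtain ⟨u, htu, hy⟩ := (hlt y ht0.le).1 (hts.trans_le h)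
        exact hq.mono (fun x hx => (htu.trans hx).le) hy
      · intro h
        by_contra! hlt'
        have hn := quasiIntegral_nonneg (w y).1 f
        -- With `∫ f < u < t < s`, the inclusion `{f ≥ t} ⊆ {f > u}` puts `y` in `q {f > u}`, so the
        -- integral would exceed itself.
        obtain ⟨t, ht, hts⟩ := exists_between hlt'
        obtain ⟨u, hut, htu⟩ := exists_between ht
        refine lt_irrefl _ ((hlt y hn).2 ⟨u, hut, ?_⟩)
        exact hq.mono (fun x hx => htu.trans_le hx) (h t ⟨hn.trans_lt ht, hts⟩)

theorem IsDImageTransformation.isKProper {q : OpenOrCompact X → OpenOrCompact Y}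
    (hq : IsDImageTransformation q) {S : Set (FiniteDTM X)} {w : Y → S}
    (hw : ∀ y, (w y).1.1 = imageAdjoint q (pointMass y).1) : IsKProper w := fun K hK => by
  rw [← eq_preimage_of_eq_imageAdjoint hw]
  exact hq.isCompact K hK

/-! ### Recovering `w` from `q`, and the bijection. -/

/-- The transformation `w⁻¹ ∘ Λ` of a continuous k-proper map `w`. -/
def preimageTransformation [LocallyCompactSpace X] {S : Set (FiniteDTM X)}
    (hS : S ⊆ SimpleDTM X) (w : Y → S) (hc : Continuous w) (hk : IsKProper w)
    (A : OpenOrCompact X) : OpenOrCompact Y :=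
  ⟨w ⁻¹' basicTransformation S A,
    A.2.imp (fun h => (isOpen_basicTransformation hS h).preimage hc) (hk A)⟩

/-- A simple measure is determined by the open or compact sets on which it equals `1`; outer
regularity settles all other closed sets. -/
theorem eq_imageAdjoint_of_eq_preimage {S : Set (FiniteDTM X)}
    (hS : S ⊆ SimpleDTM X) {w : Y → S} {q : OpenOrCompact X → OpenOrCompact Y}
    (hq : ∀ A, (q A).1 = w ⁻¹' basicTransformation S A) (y : Y) :
    (w y).1.1 = imageAdjoint q (pointMass y).1 := by
  classical
  have happ : ∀ A : OpenOrClosed X, (IsOpen A.1 ∨ IsCompact A.1) →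
      (w y).1.1 A = imageAdjoint q (pointMass y).1 A := fun A hA => by
    rw [imageAdjoint_pointMass_apply q y hA, hq]
    rcases hS (w y).2 A with h | h
    · rw [if_neg]
      · exact h
      · exact fun h1 => zero_ne_one (h.symm.trans h1)
    · rw [if_pos]
      · exact h
      · exact h
  funext A
  by_cases hA : IsOpen A.1 ∨ IsCompact A.1
  · exact happ A hA
  · rw [(w y).1.2.1.outer A (A.2.resolve_left fun h => hA (Or.inl h)), imageAdjoint, dif_neg hA]
    refine le_antisymm (le_iInf₂ fun U hU => ?_) (le_iInf₂ fun U hU => ?_)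
    · refine (iInf₂_le U.toOpenOrClosed hU).trans (le_of_eq ?_)
      rw [happ U.toOpenOrClosed U.2]
      exact dif_pos U.2
    · refine (iInf₂_le (⟨U.1, Or.inl hU.1⟩ : OpenOrCompact X) hU).trans (le_of_eq ?_)
      rw [happ _ (Or.inl hU.1), imageAdjoint, dif_pos (Or.inl hU.1)]

/-- Each of `q` and `w` determines the other by an explicit formula, so the two passages are
mutually inverse. Leaving `P` and `S` abstract serves both versions of the theorem. -/
theorem exists_equiv_transformation {S : Set (FiniteDTM X)} (hS : S ⊆ SimpleDTM X)
    {P : (OpenOrCompact X → OpenOrCompact Y) → Prop}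
    (h₁ : ∀ q, P q → ∃ w : Y → S,
      (∀ y, (w y).1.1 = imageAdjoint q (pointMass y).1) ∧ Continuous w ∧ IsKProper w ∧
        ∀ A, (q A).1 = w ⁻¹' basicTransformation S A)
    (h₂ : ∀ w : Y → S, Continuous w → IsKProper w → ∃ q : OpenOrCompact X → OpenOrCompact Y,
      (∀ A, (q A).1 = w ⁻¹' basicTransformation S A) ∧ P q ∧
        ∀ y, (w y).1.1 = imageAdjoint q (pointMass y).1) :
    ∃ e : {q : OpenOrCompact X → OpenOrCompact Y // P q} ≃
        {w : Y → S // Continuous w ∧ IsKProper w},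
      (∀ q A, (q.1 A).1 = (e q).1 ⁻¹' basicTransformation S A) ∧
      (∀ q y, ((e q).1 y).1.1 = imageAdjoint q.1 (pointMass y).1) ∧
      ∀ q, (∃ A, (q.1 A).1 ≠ ∅) ↔ ∃ y A, ((e q).1 y).1.1 A ≠ 0 := by
  choose F hF hFc hFk hFp using h₁
  choose G hG hGP hGa using h₂
  refine ⟨⟨fun q => ⟨F q.1 q.2, hFc q.1 q.2, hFk q.1 q.2⟩,
    fun w => ⟨G w.1 w.2.1 w.2.2, hGP w.1 w.2.1 w.2.2⟩, fun q => ?_, fun w => ?_⟩,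
    fun q => hFp q.1 q.2, fun q => hF q.1 q.2, fun q => ⟨?_, ?_⟩⟩
  · refine Subtype.ext (funext fun A => Subtype.ext ?_)
    exact (hG _ _ _ A).trans (hFp q.1 q.2 A).symm
  · refine Subtype.ext (funext fun y => Subtype.ext (Subtype.ext ?_))
    exact (hF _ _ y).trans (hGa w.1 w.2.1 w.2.2 y).symm
  · rintro ⟨A, hA⟩
    obtain ⟨y, hy⟩ := Set.nonempty_iff_ne_empty.2 hA
    rw [hFp q.1 q.2] at hy
    have hy1 : (F q.1 q.2 y).1.1 A.toOpenOrClosed = 1 := hy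
    exact ⟨y, A.toOpenOrClosed, fun h0 => zero_ne_one (h0.symm.trans hy1)⟩
  · rintro ⟨y, A, hA⟩
    have hA1 : (F q.1 q.2 y).1.1 A = 1 := (hS (F q.1 q.2 y).2 A).resolve_left hA
    -- The given `A` may be closed and outside the domain of `q`; by monotonicity the whole space
    -- serves instead.
    refine ⟨⟨Set.univ, Or.inl isOpen_univ⟩, Set.nonempty_iff_ne_empty.1 ⟨y, ?_⟩⟩
    rw [hFp q.1 q.2]
    exact IsSimpleSetFunction.eq_one_of_le (hS (F q.1 q.2 y).2)
      (hA1 ▸ (F q.1 q.2 y).1.2.1.mono (Set.subset_univ _))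

end Transformations

theorem mainTheorem2 {X Y : Type*} [TopologicalSpace X] [T2Space X] [LocallyCompactSpace X]
    [TopologicalSpace Y] [T2Space Y] [LocallyCompactSpace Y] :
    -- d-image transformations and `X^♭`
    ((∀ q : OpenOrCompact X → OpenOrCompact Y, IsDImageTransformation q →
        ∃ w : Y → SimpleDTM X,
          (∀ y, (w y).1.1 = imageAdjoint q (pointMass y).1) ∧ Continuous w ∧ IsKProper w ∧
            ∀ A, (q A).1 = w ⁻¹' basicTransformation (SimpleDTM X) A) ∧
      (∀ w : Y → SimpleDTM X, Continuous w → IsKProper w →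
        ∃ q : OpenOrCompact X → OpenOrCompact Y,
          (∀ A, (q A).1 = w ⁻¹' basicTransformation (SimpleDTM X) A) ∧
            IsDImageTransformation q ∧ ∀ y, (w y).1.1 = imageAdjoint q (pointMass y).1) ∧
      ∃ e : {q : OpenOrCompact X → OpenOrCompact Y // IsDImageTransformation q} ≃
          {w : Y → SimpleDTM X // Continuous w ∧ IsKProper w},
        (∀ q A, (q.1 A).1 = (e q).1 ⁻¹' basicTransformation (SimpleDTM X) A) ∧
        (∀ q y, ((e q).1 y).1.1 = imageAdjoint q.1 (pointMass y).1) ∧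
        ∀ q, (∃ A, (q.1 A).1 ≠ ∅) ↔ ∃ y A, ((e q).1 y).1.1 A ≠ 0) ∧
    -- image transformations and `X^♯`
    ((∀ q : OpenOrCompact X → OpenOrCompact Y, IsImageTransformation q →
        ∃ w : Y → SimpleTM X,
          (∀ y, (w y).1.1 = imageAdjoint q (pointMass y).1) ∧ Continuous w ∧ IsKProper w ∧
            ∀ A, (q A).1 = w ⁻¹' basicTransformation (SimpleTM X) A) ∧
      (∀ w : Y → SimpleTM X, Continuous w → IsKProper w →
        ∃ q : OpenOrCompact X → OpenOrCompact Y,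
          (∀ A, (q A).1 = w ⁻¹' basicTransformation (SimpleTM X) A) ∧
            IsImageTransformation q ∧ ∀ y, (w y).1.1 = imageAdjoint q (pointMass y).1) ∧
      ∃ e : {q : OpenOrCompact X → OpenOrCompact Y // IsImageTransformation q} ≃
          {w : Y → SimpleTM X // Continuous w ∧ IsKProper w},
        (∀ q A, (q.1 A).1 = (e q).1 ⁻¹' basicTransformation (SimpleTM X) A) ∧
        (∀ q y, ((e q).1 y).1.1 = imageAdjoint q.1 (pointMass y).1) ∧
        ∀ q, (∃ A, (q.1 A).1 ≠ ∅) ↔ ∃ y A, ((e q).1 y).1.1 A ≠ 0) := by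
  have hT : SimpleTM X ⊆ SimpleDTM X := fun _ h => h.2
  have hd₁ : ∀ q : OpenOrCompact X → OpenOrCompact Y, IsDImageTransformation q →
      ∃ w : Y → SimpleDTM X,
        (∀ y, (w y).1.1 = imageAdjoint q (pointMass y).1) ∧ Continuous w ∧ IsKProper w ∧
          ∀ A, (q A).1 = w ⁻¹' basicTransformation (SimpleDTM X) A := fun q hq =>
    ⟨fun y => ⟨hq.adjointPointMass y, isSimpleSetFunction_imageAdjoint_pointMass q y⟩,
      fun _ => rfl, hq.continuous subset_rfl fun _ => rfl, hq.isKProper fun _ => rfl,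
      eq_preimage_of_eq_imageAdjoint fun _ => rfl⟩
  have hd₂ : ∀ w : Y → SimpleDTM X, Continuous w → IsKProper w →
      ∃ q : OpenOrCompact X → OpenOrCompact Y,
        (∀ A, (q A).1 = w ⁻¹' basicTransformation (SimpleDTM X) A) ∧
          IsDImageTransformation q ∧ ∀ y, (w y).1.1 = imageAdjoint q (pointMass y).1 :=
    fun w hc hk => ⟨preimageTransformation subset_rfl w hc hk, fun _ => rfl,
      isDImageTransformation_of_eq_preimage subset_rfl hc hk fun _ => rfl,
      eq_imageAdjoint_of_eq_preimage subset_rfl fun _ => rfl⟩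
  have ht₁ : ∀ q : OpenOrCompact X → OpenOrCompact Y, IsImageTransformation q →
      ∃ w : Y → SimpleTM X,
        (∀ y, (w y).1.1 = imageAdjoint q (pointMass y).1) ∧ Continuous w ∧ IsKProper w ∧
          ∀ A, (q A).1 = w ⁻¹' basicTransformation (SimpleTM X) A := fun q hq =>
    have hq' := hq.isDImageTransformation
    ⟨fun y => ⟨hq'.adjointPointMass y, hq.imageAdjoint_pointMass y,
        isSimpleSetFunction_imageAdjoint_pointMass q y⟩,
      fun _ => rfl, hq'.continuous hT fun _ => rfl, hq'.isKProper fun _ => rfl,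
      eq_preimage_of_eq_imageAdjoint fun _ => rfl⟩
  have ht₂ : ∀ w : Y → SimpleTM X, Continuous w → IsKProper w →
      ∃ q : OpenOrCompact X → OpenOrCompact Y,
        (∀ A, (q A).1 = w ⁻¹' basicTransformation (SimpleTM X) A) ∧
          IsImageTransformation q ∧ ∀ y, (w y).1.1 = imageAdjoint q (pointMass y).1 :=
    fun w hc hk => ⟨preimageTransformation hT w hc hk, fun _ => rfl,
      isImageTransformation_of_eq_preimage hc hk fun _ => rfl,
      eq_imageAdjoint_of_eq_preimage hT fun _ => rfl⟩
  exact ⟨⟨hd₁, hd₂, exists_equiv_transformation subset_rfl hd₁ hd₂⟩,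
    ht₁, ht₂, exists_equiv_transformation hT ht₁ ht₂⟩
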